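/- Let $n\ge 0$ be an integer and let $E$ be a countable Borel equivalence relation on $\mathbb{R}^n$, i.e. an equivalence relation that is a Borel subset of $\mathbb{R}^n\times\mathbb{R}^n$ and all of whose classes are countable. An equivalence relation $F$ on a closed set $A\subseteq\mathbb{R}^n$ is called smooth if there is a Borel function $f\colon A\to\mathbb{R}$ such that $x\mathrel{F}y\iff f(x)=f(y)$ for all $x,y\in A$. A gauge function is a (weakly) increasing, right-continuous function $g\colon[0,\infty)\to[0,\infty)$ with $g(0)=0$ and $g(t)>0$ for $t>0$; it is of lower order than $t\mapsto t^n$ if $\lim_{t\to0^+}t^n/g(t)=0$. With respect to the Euclidean metric on $\mathbb{R}^n$, put $$H^g(A)=\lim_{\delta\to0^+}\ \inf\Big\{\sum_{i=0}^\infty g(\operatorname{diam}U_i) : (U_i)_{i\in\mathbb{N}}\text{ is a cover of }A\text{ by open sets of diameter}<\delta\Big\}.$$ Then: 1. for every gauge function $g$ of lower order than $t\mapsto t^n$ there is a closed set $A\subseteq[0,1]^n$ such that the restriction $E\restriction A$ is smooth and $H^g(A)>0$; 2. there is a closed set $A\subseteq[0,1]^n$ of Hausdorff dimension $n$ such that $E\restriction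 A$ is smooth. -/

import Mathlib

open Filter Topology MeasureTheory
open scoped NNReal ENNReal

/-- A gauge function `g : [0,∞) → [0,∞)`: increasing (in the weak sense), continuous on the right,
`g 0 = 0`, and `g t > 0` for `t > 0`. -/
structure IsGauge (g : ℝ≥0 → ℝ≥0) : Prop where
  monotone : Monotone g
  rightContinuous : ∀ t, ContinuousWithinAt g (Set.Ici t) t
  map_zero : g 0 = 0
  pos : ∀ t, 0 < t → 0 < g t

/-- `f` has lower order than `g` (equivalently, `g` has higher order than `f`):
`g t / f t → 0` as `t → 0⁺`. -/
def LowerOrder (f g : ℝ≥0 → ℝ≥0) : Prop :=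
  Tendsto (fun t => g t / f t) (𝓝[>] 0) (𝓝 0)

/-- `H^g_δ(A)`: the infimum of `∑ g (diam (U i))` over the countable covers `(U i)` of `A` by open
sets of diameter `< δ`. Diameters are `< δ < ∞`, so that `toNNReal` loses nothing. -/
noncomputable def gaugePreMeasure {X : Type*} [PseudoEMetricSpace X] (g : ℝ≥0 → ℝ≥0) (δ : ℝ≥0)
    (A : Set X) : ℝ≥0∞ :=
  ⨅ (U : ℕ → Set X) (_ : ∀ i, IsOpen (U i)) (_ : A ⊆ ⋃ i, U i)
    (_ : ∀ i, Metric.ediam (U i) < (δ : ℝ≥0∞)),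
    ∑' i, (g (Metric.ediam (U i)).toNNReal : ℝ≥0∞)

/-- The `g`-measure `H^g(A) = lim_{δ → 0⁺} H^g_δ(A)`. As `H^g_δ(A)` increases when `δ` decreases,
the limit is the supremum over `δ > 0`. -/
noncomputable def gaugeMeasure {X : Type*} [PseudoEMetricSpace X] (g : ℝ≥0 → ℝ≥0)
    (A : Set X) : ℝ≥0∞ :=
  ⨆ (δ : ℝ≥0) (_ : 0 < δ), gaugePreMeasure g δ A

/-- The limit in the definition of the `g`-measure exists and is the supremum. -/
theorem tendsto_gaugePreMeasure {X : Type*} [PseudoEMetricSpace X] (g : ℝ≥0 → ℝ≥0) (A : Set X) :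
    Tendsto (fun δ => gaugePreMeasure g δ A) (𝓝[>] 0) (𝓝 (gaugeMeasure g A)) := by
  have hanti : Antitone (fun δ => gaugePreMeasure g δ A) := by
    intro δ ε h
    refine le_iInf fun U => le_iInf fun hU => le_iInf fun hA => le_iInf fun hd => ?_
    exact iInf_le_of_le U (iInf_le_of_le hU (iInf_le_of_le hA (iInf_le_of_le
      (fun i => (hd i).trans_le (by exact_mod_cast h)) le_rfl)))
  rw [tendsto_order]
  constructor
  · intro a ha
    obtain ⟨δ, hδ, h⟩ : ∃ δ : ℝ≥0, 0 < δ ∧ a < gaugePreMeasure g δ A := by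
      simpa [gaugeMeasure, lt_iSup_iff] using ha
    filter_upwards [Ioo_mem_nhdsGT hδ] with ε hε
    exact h.trans_le (hanti hε.2.le)
  · intro a ha
    filter_upwards [self_mem_nhdsWithin] with ε hε
    exact lt_of_le_of_lt (le_iSup₂_of_le ε hε le_rfl) ha

/-- A countable Borel equivalence relation: it is Borel as a subset of `X × X` and all of its
classes are countable. -/
structure IsCountableBorel {X : Type*} [MeasurableSpace X] (E : Setoid X) : Prop where
  measurableSet : MeasurableSet {p : X × X | E p.1 p.2}
  countable : ∀ x, {y | E y x}.Countable

/-- Borel reducibility `E ≤_B F` of equivalence relations. -/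
def BorelReducible {X Y : Type*} [MeasurableSpace X] [MeasurableSpace Y] (E : Setoid X)
    (F : Setoid Y) : Prop :=
  ∃ f : X → Y, Measurable f ∧ ∀ x₀ x₁, E x₀ x₁ ↔ F (f x₀) (f x₁)

/-- `E` is smooth: it is Borel reducible to equality on `ℝ`. -/
def IsSmooth {X : Type*} [MeasurableSpace X] (E : Setoid X) : Prop :=
  BorelReducible E (⊥ : Setoid ℝ)

/-- The restriction of the equivalence relation `E` to the set `A`. -/
def restrictSetoid {X : Type*} (E : Setoid X) (A : Set X) : Setoid A :=
  E.comap Subtype.val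

/-- The unit cube `[0,1]^n` in `ℝ^n`. -/
def unitCube (n : ℕ) : Set (EuclideanSpace ℝ (Fin n)) :=
  {x | ∀ i, x i ∈ Set.Icc (0 : ℝ) 1}

/-! Off the diagonal and up to a null set, `E` is a countable union of partial injections `T k` and
their converses: this is the Lusin-Novikov theorem, of which an almost everywhere version follows by
exhaustion, since a countable closed set has no nonempty perfect part. A measure in which points are
null can be halved on the domain and, complementarily, on the range of `T k`, simultaneously inside
all cells of a countable partition, which gives a closed set `K k` avoiding `T k` that carries at
least a quarter of each cell. Starting from a compact set of positive measure, rescale the measure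
successively to live on `K 0`, `K 1`, ..., keeping the masses of the cells of finer and finer
partitions: the `k`-th measure has density at most `4 ^ k`, and at scales coarser than the mesh of
the `k`-th partition it agrees with its successors. If the meshes decrease so fast that
`4 ^ k * t ^ s ≤ g t` below the `k`-th one, then all these measures are bounded by a fixed multiple
of `g (diam U)`, and compactness makes `H^g` positive on the intersection of the `K k`, where no two
distinct points are equivalent. The gauge `t ^ s * (1 + |log t|)` gives the statement on
dimension. -/

section AnalyticSets

theorem isCompact_Iic_of_orderBot {β : Type*} [Preorder β] [OrderBot β] [TopologicalSpace β]
    [CompactIccSpace β] (b : β) : IsCompact (Set.Iic b) :=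
  Set.Icc_bot (a := b) ▸ isCompact_Icc

variable {α : Type*} [TopologicalSpace α] {f : (ℕ → ℕ) → α}

theorem exists_image_bounded_subset_of_isOpen (hf : Continuous f) {b : ℕ → ℕ} {V : Set α}
    (hV : IsOpen V) (hb : f '' Set.Iic b ⊆ V) :
    ∃ k, f '' {σ | ∀ i < k, σ i ≤ b i} ⊆ V := by
  have hcylinder : ∀ τ ≤ b, ∃ k, PiNat.cylinder τ k ⊆ f ⁻¹' V := by
    intro τ hτ
    obtain ⟨_, ⟨y, k, rfl⟩, hτy, hsub⟩ :=
      (PiNat.isTopologicalBasis_cylinders fun _ => ℕ).mem_nhds_iff.1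
        ((hV.preimage hf).mem_nhds (hb ⟨τ, hτ, rfl⟩))
    exact ⟨k, by rwa [PiNat.mem_cylinder_iff_eq.1 hτy]⟩
  choose! k hk using hcylinder
  obtain ⟨t, ht, hcover⟩ := (isCompact_Iic_of_orderBot b).elim_nhds_subcover
    (fun τ => PiNat.cylinder τ (k τ)) fun τ _ =>
      (PiNat.isOpen_cylinder _ τ _).mem_nhds (PiNat.self_mem_cylinder τ _)
  refine ⟨t.sup k, ?_⟩
  rintro _ ⟨σ, hσ, rfl⟩
  obtain ⟨τ, hτ, hστ⟩ := Set.mem_iUnion₂.1 (@hcover (fun i => min (σ i) (b i))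
    fun i => min_le_right _ _)
  refine hk τ (ht τ hτ) fun i hi => ?_
  have hσi : σ i ≤ b i := hσ i (hi.trans_le (Finset.le_sup (f := k) hτ))
  exact (min_eq_left hσi).symm.trans (hστ i hi)

theorem iInter_closure_image_bounded_subset [T2Space α] (hf : Continuous f) (b : ℕ → ℕ) :
    ⋂ k, closure (f '' {σ | ∀ i < k, σ i ≤ b i}) ⊆ f '' Set.Iic b := by
  intro x hx
  by_contra hxK
  obtain ⟨V, W, hV, hW, hKV, hxW, hVW⟩ := SeparatedNhds.of_isCompact_isCompact
    ((isCompact_Iic_of_orderBot b).image hf) (isCompact_singleton (x := x))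
      (Set.disjoint_singleton_right.2 hxK)
  obtain ⟨k, hk⟩ := exists_image_bounded_subset_of_isOpen hf hV hKV
  obtain ⟨y, hyW, hy⟩ := mem_closure_iff.1 (Set.mem_iInter.1 hx k) W hW (hxW rfl)
  exact Set.disjoint_left.1 hVW (hk hy) hyW

theorem exists_lt_measure_image_inter {β γ : Type*} [MeasurableSpace β] (μ : Measure β)
    (f : γ → β) (n : γ → ℕ) {s : Set γ} {c : ℝ≥0∞} (hc : c < μ (f '' s)) :
    ∃ m, c < μ (f '' (s ∩ {x | n x ≤ m})) := by
  have hmono : Monotone fun m : ℕ => f '' (s ∩ {x | n x ≤ m}) := fun m m' h =>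
    Set.image_mono fun x hx => ⟨hx.1, hx.2.trans h⟩
  have hunion : ⋃ m : ℕ, f '' (s ∩ {x | n x ≤ m}) = f '' s := by
    rw [← Set.image_iUnion, ← Set.inter_iUnion, Set.inter_eq_left.2]
    exact fun x _ => Set.mem_iUnion.2 ⟨n x, le_refl (n x)⟩
  rw [← hunion, hmono.measure_iUnion] at hc
  exact lt_iSup_iff.1 hc

theorem exists_forall_lt_measure_image_bounded {β : Type*} [MeasurableSpace β] (μ : Measure β)
    (f : (ℕ → ℕ) → β) {c : ℝ≥0∞} (hc : c < μ (Set.range f)) :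
    ∃ b : ℕ → ℕ, ∀ k, c < μ (f '' {σ | ∀ i < k, σ i ≤ b i}) := by
  choose m hm using fun (k : ℕ) (s : {s : Set (ℕ → ℕ) // c < μ (f '' s)}) =>
    exists_lt_measure_image_inter μ f (fun σ => σ k) s.2
  let S : ℕ → {s : Set (ℕ → ℕ) // c < μ (f '' s)} := fun k =>
    Nat.rec ⟨Set.univ, by rwa [Set.image_univ]⟩ (fun k s => ⟨_, hm k s⟩) k
  have hS : ∀ k, (S k).1 = {σ | ∀ i < k, σ i ≤ m i (S i)} := by
    intro k
    induction k with
    | zero => simp [S]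
    | succ k ih =>
      change (S k).1 ∩ {σ | σ k ≤ m k (S k)} = _
      rw [ih]
      ext σ
      exact Nat.forall_lt_succ_right.symm
  exact ⟨fun k => m k (S k), fun k => hS k ▸ (S k).2⟩

variable [T2Space α] [MeasurableSpace α] [BorelSpace α]

theorem exists_isCompact_subset_range_le_measure (μ : Measure α) [IsFiniteMeasure μ]
    (hf : Continuous f) {c : ℝ≥0∞} (hc : c < μ (Set.range f)) :
    ∃ K ⊆ Set.range f, IsCompact K ∧ c ≤ μ K := by
  obtain ⟨b, hb⟩ := exists_forall_lt_measure_image_bounded μ f hc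
  have hanti : Antitone fun k => closure (f '' {σ | ∀ i < k, σ i ≤ b i}) := fun k l h =>
    closure_mono (Set.image_mono fun σ hσ i hi => hσ i (hi.trans_le h))
  refine ⟨f '' Set.Iic b, Set.image_subset_range _ _, (isCompact_Iic_of_orderBot b).image hf, ?_⟩
  calc c ≤ ⨅ k, μ (closure (f '' {σ | ∀ i < k, σ i ≤ b i})) :=
        le_iInf fun k => (hb k).le.trans (measure_mono subset_closure)
    _ = μ (⋂ k, closure (f '' {σ | ∀ i < k, σ i ≤ b i})) :=
        (hanti.measure_iInter (fun k => isClosed_closure.nullMeasurableSet)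
          ⟨0, measure_ne_top _ _⟩).symm
    _ ≤ μ (f '' Set.Iic b) := measure_mono (iInter_closure_image_bounded_subset hf b)

theorem nullMeasurableSet_of_analyticSet {s : Set α} (hs : AnalyticSet s) (μ : Measure α)
    [IsFiniteMeasure μ] : NullMeasurableSet s μ := by
  rw [AnalyticSet] at hs
  rcases hs with rfl | ⟨f, hf, rfl⟩
  · exact nullMeasurableSet_empty
  rcases eq_or_ne (μ (Set.range f)) 0 with h0 | h0
  · exact NullMeasurableSet.of_null h0
  obtain ⟨u, -, hu, hlim⟩ := exists_seq_strictMono_tendsto' (pos_iff_ne_zero.2 h0)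
  choose K hKs hK hKu using fun n => exists_isCompact_subset_range_le_measure μ hf (hu n).2
  have hmeas : MeasurableSet (⋃ n, K n) := MeasurableSet.iUnion fun n => (hK n).measurableSet
  have hle : μ (Set.range f) ≤ μ (⋃ n, K n) := le_of_tendsto' hlim fun n =>
    (hKu n).trans (measure_mono (Set.subset_iUnion K n))
  exact hmeas.nullMeasurableSet.congr (ae_eq_of_subset_of_measure_ge (Set.iUnion_subset hKs) hle
    hmeas.nullMeasurableSet (measure_ne_top _ _))

end AnalyticSets

section LusinNovikov

theorem preperfect_eq_empty_of_subset_countable {Z : Type*} [TopologicalSpace Z] [PolishSpace Z]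
    {R C : Set Z} (hR : Preperfect R) (hRC : R ⊆ C) (hC : IsClosed C) (hcount : C.Countable) :
    R = ∅ := by
  by_contra hne
  have : Uncountable (ℕ → Bool) :=
    Cardinal.aleph0_lt_mk_iff.1 (by simp [Cardinal.aleph0_lt_continuum])
  let _ := TopologicalSpace.upgradeIsCompletelyMetrizable Z
  obtain ⟨f, hf, -, hinj⟩ := hR.perfect_closure.exists_nat_bool_injection
    (Set.nonempty_iff_ne_empty.2 hne).closure
  have hrange : (Set.range f).Countable := hcount.mono (hf.trans (closure_minimal hRC hC))
  refine not_countable (α := ℕ → Bool) (Set.countable_univ_iff.1 ?_)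
  exact Set.countable_of_injective_of_countable_image hinj.injOn (by rwa [Set.image_univ])

variable {X Z : Type*} [MeasurableSpace Z]

/-- `S` is a countable union of measurable sets on each of which `π` is injective, that is, of
graphs of Borel sections of `π` over subsets of its range. -/
def IsCountableUnionOfSections (π : Z → X) (S : Set Z) : Prop :=
  ∃ 𝒯 : Set (Set Z), 𝒯.Countable ∧ (∀ T ∈ 𝒯, MeasurableSet T ∧ Set.InjOn π T) ∧ ⋃₀ 𝒯 = S

namespace IsCountableUnionOfSections

variable {π : Z → X}

theorem measurableSet {S : Set Z} (h : IsCountableUnionOfSections π S) : MeasurableSet S := by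
  obtain ⟨𝒯, hcount, h𝒯, rfl⟩ := h
  exact .sUnion hcount fun T hT => (h𝒯 T hT).1

theorem of_injOn {T : Set Z} (hT : MeasurableSet T) (hinj : Set.InjOn π T) :
    IsCountableUnionOfSections π T :=
  ⟨{T}, Set.countable_singleton T, by simp [hT, hinj], Set.sUnion_singleton T⟩

theorem iUnion {ι : Type*} [Countable ι] {S : ι → Set Z}
    (h : ∀ i, IsCountableUnionOfSections π (S i)) : IsCountableUnionOfSections π (⋃ i, S i) := by
  choose 𝒯 hcount h𝒯 hS using h
  refine ⟨⋃ i, 𝒯 i, Set.countable_iUnion hcount, fun T hT => ?_, ?_⟩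
  · obtain ⟨i, hi⟩ := Set.mem_iUnion.1 hT
    exact h𝒯 i T hi
  · simp only [Set.sUnion_iUnion, hS]

theorem union {S T : Set Z} (hS : IsCountableUnionOfSections π S)
    (hT : IsCountableUnionOfSections π T) : IsCountableUnionOfSections π (S ∪ T) := by
  rw [Set.union_eq_iUnion]
  exact iUnion (Bool.forall_bool.2 ⟨hT, hS⟩)

theorem exists_minimal (π : Z → X) {F : ℕ → Set Z → ℝ≥0∞} (hF : ∀ n, Antitone (F n)) :
    ∃ S, IsCountableUnionOfSections π S ∧
      ∀ n S', IsCountableUnionOfSections π S' → F n S ≤ F n S' := by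
  have hempty : IsCountableUnionOfSections π ∅ := of_injOn .empty (Set.injOn_empty _)
  choose u _ hlim hu using fun n => exists_seq_tendsto_sInf
    ((Set.nonempty_of_mem (s := {S | IsCountableUnionOfSections π S}) hempty).image (F n))
    (OrderBot.bddBelow _)
  choose S hS hSu using hu
  refine ⟨⋃ n, ⋃ j, S n j, iUnion fun n => iUnion fun j => hS n j, fun n S' hS' => ?_⟩
  have hle : ∀ j, F n (⋃ n, ⋃ j, S n j) ≤ u n j := fun j =>
    (hF n (Set.subset_iUnion₂ (s := S) n j)).trans_eq (hSu n j)
  exact (ge_of_tendsto' (hlim n) hle).trans (sInf_le (Set.mem_image_of_mem _ hS'))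

theorem exists_seq {S : Set Z} (h : IsCountableUnionOfSections π S) :
    ∃ T : ℕ → Set Z, (∀ k, MeasurableSet (T k) ∧ Set.InjOn π (T k)) ∧ ⋃ k, T k = S := by
  obtain ⟨𝒯, hcount, h𝒯, rfl⟩ := h
  obtain ⟨T, hT⟩ := (hcount.insert ∅).exists_eq_range (Set.insert_nonempty _ _)
  refine ⟨T, fun k => ?_, by rw [← Set.sUnion_range, ← hT, Set.sUnion_insert, Set.empty_union]⟩
  rcases hT.symm.subset (Set.mem_range_self k) with hk | hk
  · exact hk ▸ ⟨.empty, Set.injOn_empty π⟩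
  · exact h𝒯 _ hk

end IsCountableUnionOfSections

variable [MeasurableSpace X] [TopologicalSpace X] [PolishSpace X] [BorelSpace X] {π : Z → X}

theorem analyticSet_nontrivial_fiber [StandardBorelSpace Z] (hπ : Measurable π) {W : Set Z}
    (hW : MeasurableSet W) : AnalyticSet {x | (W ∩ π ⁻¹' {x}).Nontrivial} := by
  have hpairs : MeasurableSet {q : Z × Z | (q.1 ∈ W ∧ q.2 ∈ W) ∧ q.1 ≠ q.2 ∧ π q.1 = π q.2} :=
    (hW.prod hW).inter ((measurableSet_eq_fun measurable_fst measurable_snd).compl.inter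
      (measurableSet_eq_fun (hπ.comp measurable_fst) (hπ.comp measurable_snd)))
  convert hpairs.analyticSet_image (hπ.comp measurable_fst) using 1
  ext x
  constructor
  · rintro ⟨z, ⟨hz, rfl⟩, z', ⟨hz', h⟩, hne⟩
    exact ⟨(z, z'), ⟨⟨hz, hz'⟩, hne, h.symm⟩, rfl⟩
  · rintro ⟨⟨z, z'⟩, ⟨⟨hz, hz'⟩, hne, h⟩, rfl⟩
    exact ⟨z, ⟨hz, rfl⟩, z', ⟨hz', h.symm⟩, hne⟩

theorem ae_nontrivial_fiber_of_minimal [StandardBorelSpace Z] (μ : Measure X) [IsFiniteMeasure μ]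
    (hπ : Measurable π) {W : Set Z} (hW : MeasurableSet W)
    (hmin : ∀ T, MeasurableSet T → Set.InjOn π T → μ (π '' W) ≤ μ (π '' (W \ T))) :
    ∀ᵐ x ∂μ, x ∈ π '' W → (W ∩ π ⁻¹' {x}).Nontrivial := by
  -- Deleting the part of `W` over a set `V` of points with one-point fibre deletes `V` from the
  -- projection, so minimality forces `μ V = 0`.
  obtain ⟨V, hVsub, hV, hVae⟩ := (((nullMeasurableSet_of_analyticSet
    (hW.analyticSet_image hπ) μ).diff (nullMeasurableSet_of_analyticSet
      (analyticSet_nontrivial_fiber hπ hW) μ))).exists_measurable_subset_ae_eq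
  have hinj : Set.InjOn π (W ∩ π ⁻¹' V) := by
    intro z hz z' hz' h
    by_contra hne
    exact (hVsub hz.2).2 ⟨z, ⟨hz.1, rfl⟩, z', ⟨hz'.1, h.symm⟩, hne⟩
  have himage : π '' (W \ (W ∩ π ⁻¹' V)) ⊆ π '' W \ V := by
    rintro _ ⟨z, ⟨hzW, hz⟩, rfl⟩
    exact ⟨⟨z, hzW, rfl⟩, fun h => hz ⟨hzW, h⟩⟩
  have hle : μ (π '' W) ≤ μ (π '' W \ V) :=
    (hmin _ (hW.inter (hπ hV)) hinj).trans (measure_mono himage)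
  have hV0 : μ V = 0 := by
    have hsplit := measure_inter_add_sdiff (μ := μ) (π '' W) hV
    rw [Set.inter_eq_right.2 (hVsub.trans Set.sdiff_subset)] at hsplit
    have : μ V + μ (π '' W \ V) ≤ 0 + μ (π '' W \ V) := by rwa [hsplit, zero_add]
    exact le_zero_iff.1 ((ENNReal.add_le_add_iff_right (measure_ne_top _ _)).1 this)
  filter_upwards [measure_eq_zero_iff_ae_notMem.1 ((measure_congr hVae).symm.trans hV0)]
    with x hx hxW
  by_contra hfiber
  exact hx ⟨hxW, hfiber⟩

theorem exists_ae_fiber_subset_of_continuous [TopologicalSpace Z] [PolishSpace Z] [BorelSpace Z]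
    (μ : Measure X) [IsFiniteMeasure μ] (hπ : Continuous π) (hcount : ∀ x, (π ⁻¹' {x}).Countable) :
    ∃ S, IsCountableUnionOfSections π S ∧ ∀ᵐ x ∂μ, π ⁻¹' {x} ⊆ S := by
  obtain ⟨U, hU⟩ := TopologicalSpace.exists_seq_basis Z
  obtain ⟨S, hS, hmin⟩ := IsCountableUnionOfSections.exists_minimal π
    (F := fun n S => μ (π '' (U n \ S))) fun n S S' h =>
      measure_mono (Set.image_mono (Set.sdiff_subset_sdiff_right h))
  have hfiber : ∀ n, ∀ᵐ x ∂μ, x ∈ π '' (U n \ S) → (U n \ S ∩ π ⁻¹' {x}).Nontrivial := by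
    refine fun n => ae_nontrivial_fiber_of_minimal μ hπ.measurable
      ((hU.isOpen ⟨n, rfl⟩).measurableSet.diff hS.measurableSet) fun T hT hinj => ?_
    rw [sdiff_sdiff]
    exact hmin n _ (hS.union (.of_injOn hT hinj))
  refine ⟨S, hS, ?_⟩
  -- An isolated point of `π ⁻¹' {x} \ S` would be the only point of some `U n \ S` over `x`.
  filter_upwards [ae_all_iff.2 hfiber] with x hx
  have hperf : Preperfect (π ⁻¹' {x} \ S) := by
    rw [preperfect_iff_nhds]
    rintro w ⟨hwx, hwS⟩ N hN
    obtain ⟨_, ⟨n, rfl⟩, hwn, hsub⟩ := hU.mem_nhds_iff.1 hN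
    obtain ⟨z, ⟨⟨hzn, hzS⟩, hzx⟩, hne⟩ := (hx n ⟨w, ⟨hwn, hwS⟩, hwx⟩).exists_ne w
    exact ⟨z, ⟨hsub hzn, hzx, hzS⟩, hne⟩
  exact Set.sdiff_eq_empty.1 (preperfect_eq_empty_of_subset_countable hperf Set.sdiff_subset
    (isClosed_singleton.preimage hπ) (hcount x))

theorem exists_ae_fiber_subset [hZ : StandardBorelSpace Z] (μ : Measure X) [IsFiniteMeasure μ]
    (hπ : Measurable π) (hcount : ∀ x, (π ⁻¹' {x}).Countable) :
    ∃ S, IsCountableUnionOfSections π S ∧ ∀ᵐ x ∂μ, π ⁻¹' {x} ⊆ S := by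
  obtain ⟨t, hborel, hpolish⟩ := hZ.polish
  obtain ⟨t', ht', hcont, hpolish'⟩ := hπ.exists_continuous
  have hborel' : @BorelSpace Z t' _ := @BorelSpace.mk Z t' _
    (hborel.measurable_eq.trans (borel_eq_borel_of_le hpolish' hpolish ht').symm)
  exact @exists_ae_fiber_subset_of_continuous X Z _ _ _ _ _ π t' hpolish' hborel' μ _ hcont hcount

end LusinNovikov

section PartialInjections

variable {X : Type*} [MeasurableSpace X]

/-- `T` is the graph of a Borel injection between two disjoint subsets of `X`. -/
structure IsPartialInjection (T : Set (X × X)) : Prop where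
  measurableSet : MeasurableSet T
  injOn_fst : Set.InjOn Prod.fst T
  injOn_snd : Set.InjOn Prod.snd T
  disjoint_image : Disjoint (Prod.fst '' T) (Prod.snd '' T)

theorem isPartialInjection_inter_swap_inter_prod {P Q : Set (X × X)} {D : Set X}
    (hP : MeasurableSet P) (hPinj : Set.InjOn Prod.fst P) (hQ : MeasurableSet Q)
    (hQinj : Set.InjOn Prod.fst Q) (hD : MeasurableSet D) :
    IsPartialInjection ((P ∩ Prod.swap ⁻¹' Q) ∩ D ×ˢ Dᶜ) where
  measurableSet := (hP.inter (measurable_swap hQ)).inter (hD.prod hD.compl)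
  injOn_fst := hPinj.mono fun _ hp => hp.1.1
  injOn_snd _ hp _ hq h := Prod.swap_injective (hQinj hp.1.2 hq.1.2 h)
  disjoint_image := by
    rw [Set.disjoint_left]
    rintro _ ⟨p, hp, rfl⟩ ⟨q, hq, h⟩
    exact hq.2.2 (h ▸ hp.2.1)

variable [TopologicalSpace X] [PolishSpace X] [BorelSpace X] {E : Setoid X}

theorem IsCountableBorel.exists_partialFunctions (hE : IsCountableBorel E) (μ : Measure X)
    [IsFiniteMeasure μ] :
    ∃ P : ℕ → Set (X × X), (∀ k, MeasurableSet (P k) ∧ Set.InjOn Prod.fst (P k)) ∧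
      ∀ᵐ x ∂μ, ∀ y, E x y → ∃ k, (x, y) ∈ P k := by
  have := hE.measurableSet.standardBorel
  have hcount (x : X) :
      ((fun p : {p : X × X | E p.1 p.2} => p.1.1) ⁻¹' {x}).Countable := by
    refine Set.MapsTo.countable_of_injOn (f := fun p => p.1.2) (t := {y | E y x}) ?_ ?_
      (hE.countable x)
    · rintro ⟨⟨a, b⟩, hab⟩ rfl
      exact E.symm hab
    · rintro ⟨⟨a, b⟩, hab⟩ rfl ⟨⟨a', b'⟩, hab'⟩ ha hb
      exact Subtype.ext (Prod.ext ha.symm hb)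
  obtain ⟨S, hS, hcover⟩ := exists_ae_fiber_subset μ (by fun_prop) hcount
  obtain ⟨T, hT, rfl⟩ := hS.exists_seq
  refine ⟨fun k => Subtype.val '' T k, fun k => ⟨hE.measurableSet.subtype_image (hT k).1, ?_⟩, ?_⟩
  · rintro _ ⟨p, hp, rfl⟩ _ ⟨q, hq, rfl⟩ h
    exact congrArg _ ((hT k).2 hp hq h)
  · filter_upwards [hcover] with x hx y hxy
    obtain ⟨k, hk⟩ := Set.mem_iUnion.1 (@hx ⟨(x, y), hxy⟩ rfl)
    exact ⟨k, _, hk, rfl⟩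

theorem IsCountableBorel.exists_partialInjections (hE : IsCountableBorel E) (μ : Measure X)
    [IsFiniteMeasure μ] :
    ∃ T : ℕ → Set (X × X), (∀ k, IsPartialInjection (T k)) ∧
      ∃ G, MeasurableSet G ∧ μ Gᶜ = 0 ∧
        ∀ x ∈ G, ∀ y ∈ G, E x y → x ≠ y → ∃ k, (x, y) ∈ T k ∨ (y, x) ∈ T k := by
  obtain ⟨P, hP, hcover⟩ := hE.exists_partialFunctions μ
  obtain ⟨D, hD, hsep⟩ := exists_seq_separating X MeasurableSet.empty Set.univ
  obtain ⟨e, he⟩ := exists_surjective_nat (ℕ × ℕ × ℕ)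
  let T : ℕ × ℕ × ℕ → Set (X × X) := fun (i, j, l) =>
    (P i ∩ Prod.swap ⁻¹' P j) ∩ D l ×ˢ (D l)ᶜ
  have hmem : ∀ {x y l}, (∃ i, (x, y) ∈ P i) → (∃ j, (y, x) ∈ P j) → x ∈ D l → y ∉ D l →
      ∃ k, (x, y) ∈ T (e k) := by
    rintro x y l ⟨i, hi⟩ ⟨j, hj⟩ hx hy
    obtain ⟨k, hk⟩ := he (i, j, l)
    exact ⟨k, hk ▸ ⟨⟨hi, hj⟩, hx, hy⟩⟩
  obtain ⟨N, hNsub, hN, hN0⟩ := exists_measurable_superset_of_null (ae_iff.1 hcover)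
  have hgood : ∀ x ∈ Nᶜ, ∀ y, E x y → ∃ k, (x, y) ∈ P k := fun x hx =>
    not_not.1 fun h => hx (hNsub h)
  refine ⟨fun k => T (e k), fun k => isPartialInjection_inter_swap_inter_prod (hP _).1 (hP _).2
    (hP _).1 (hP _).2 (hD _), Nᶜ, hN.compl, by rwa [compl_compl], fun x hx y hy hxy hne => ?_⟩
  have hPxy := hgood x hx y hxy
  have hPyx := hgood y hy x (E.symm hxy)
  obtain ⟨l, hl⟩ : ∃ l, ¬ (x ∈ D l ↔ y ∈ D l) := by
    by_contra! h
    exact hne (hsep x trivial y trivial h)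
  by_cases hxl : x ∈ D l
  · have hyl : y ∉ D l := fun h => hl (iff_of_true hxl h)
    exact (hmem hPxy hPyx hxl hyl).imp fun k => Or.inl
  · have hyl : y ∈ D l := not_not.1 fun h => hl (iff_of_false hxl h)
    exact (hmem hPyx hPxy hyl hxl).imp fun k => Or.inr

end PartialInjections

section Halving

theorem exists_measureReal_Iic_eq_half (μ : Measure ℝ) [IsFiniteMeasure μ] [NullSingletonClass μ] :
    ∃ t, μ.real (Set.Iic t) = μ.real Set.univ / 2 := by
  have hcont : Continuous fun t => μ.real (Set.Iic t) := by
    have h := intervalIntegral.continuous_primitive (μ := μ) (f := fun _ => (1 : ℝ))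
      (fun _ _ => intervalIntegrable_const) 0
    convert h.add (continuous_const (y := μ.real (Set.Iic 0))) using 2 with t
    rw [Pi.add_apply, ← intervalIntegral.integral_Iic_sub_Iic (integrable_const _).integrableOn
      (integrable_const _).integrableOn]
    simp
  have htop : Tendsto (fun t => μ.real (Set.Iic t)) atTop (𝓝 (μ.real Set.univ)) :=
    (ENNReal.tendsto_toReal (measure_ne_top _ _)).comp (tendsto_measure_Iic_atTop μ)
  have hbot : Tendsto (fun t => μ.real (Set.Iic t)) atBot (𝓝 0) := by
    have h : Tendsto (fun t => μ.real (Set.Ici t)) atBot (𝓝 (μ.real Set.univ)) :=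
      (ENNReal.tendsto_toReal (measure_ne_top _ _)).comp (tendsto_measure_Ici_atBot μ)
    convert h.const_sub (μ.real Set.univ) using 2 with t
    · rw [← measureReal_congr Iio_ae_eq_Iic, ← Set.compl_Ici, measureReal_compl measurableSet_Ici]
    · rw [sub_self]
  rcases (measureReal_nonneg : 0 ≤ μ.real Set.univ).eq_or_lt with h0 | h0
  · refine ⟨0, le_antisymm ?_ ?_⟩
    · exact (measureReal_mono (Set.subset_univ _)).trans (by linarith)
    · rw [← h0, zero_div]
      exact measureReal_nonneg
  · exact mem_range_of_exists_le_of_exists_ge hcont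
      ((hbot.eventually_le_const (half_pos h0)).exists)
      ((htop.eventually_const_le (half_lt_self h0)).exists)

theorem measure_le_of_forall_singleton_le {κ : Type*} [Countable κ] [MeasurableSpace κ]
    [MeasurableSingletonClass κ] {μ ν : Measure κ} (h : ∀ v, μ {v} ≤ ν {v}) : μ ≤ ν := by
  intro V
  rw [← μ.tsum_indicator_apply_singleton V V.to_countable.measurableSet,
    ← ν.tsum_indicator_apply_singleton V V.to_countable.measurableSet]
  exact ENNReal.tsum_le_tsum fun v => Set.indicator_le_indicator (h v)

theorem measure_preimage_inter_le_half_of_singleton {Ω κ : Type*} [MeasurableSpace Ω] [Countable κ]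
    [MeasurableSpace κ] [MeasurableSingletonClass κ] {r : Ω → κ} (hr : Measurable r)
    {μ : Measure Ω} {S : Set Ω}
    (h : ∀ v, μ (r ⁻¹' {v} ∩ S) ≤ μ (r ⁻¹' {v}) / 2) (V : Set κ) :
    μ (r ⁻¹' V ∩ S) ≤ μ (r ⁻¹' V) / 2 := by
  have hle : (μ.restrict S).map r ≤ (2⁻¹ : ℝ≥0∞) • μ.map r := by
    refine measure_le_of_forall_singleton_le fun v => ?_
    have hv := measurableSet_singleton v
    rw [Measure.map_apply hr hv, Measure.restrict_apply (hr hv), Measure.smul_apply,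
      Measure.map_apply hr hv, smul_eq_mul, mul_comm]
    exact h v
  have hV : MeasurableSet V := V.to_countable.measurableSet
  have hleV := hle V
  rwa [Measure.map_apply hr hV, Measure.restrict_apply (hr hV), Measure.smul_apply,
    Measure.map_apply hr hV, smul_eq_mul, mul_comm] at hleV

variable {Ω : Type*} [MeasurableSpace Ω] [StandardBorelSpace Ω]

theorem exists_measurableSet_measure_eq_half (μ : Measure Ω) [IsFiniteMeasure μ]
    [NullSingletonClass μ] : ∃ A, MeasurableSet A ∧ μ A = μ Set.univ / 2 := by
  have he := measurableEmbedding_embeddingReal Ω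
  have : NullSingletonClass (μ.map (embeddingReal Ω)) := ⟨fun t => by
    rw [he.map_apply]
    exact (Set.subsingleton_singleton.preimage he.injective).measure_zero μ⟩
  obtain ⟨t, ht⟩ := exists_measureReal_Iic_eq_half (μ.map (embeddingReal Ω))
  refine ⟨embeddingReal Ω ⁻¹' Set.Iic t, he.measurable measurableSet_Iic, ?_⟩
  rw [← he.map_apply, ← Set.preimage_univ (f := embeddingReal Ω), ← he.map_apply,
    ← ofReal_measureReal, ht, ENNReal.ofReal_div_of_pos two_pos, ofReal_measureReal,
    ENNReal.ofReal_ofNat]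

variable (α β : Measure Ω) [IsFiniteMeasure α] [NullSingletonClass α]

theorem exists_measure_le_half_measure_sdiff_le_half {P : Set Ω} (hP : MeasurableSet P) :
    ∃ Q ⊆ P, MeasurableSet Q ∧ α Q ≤ α P / 2 ∧ β (P \ Q) ≤ β P / 2 := by
  obtain ⟨A, hA, hhalf⟩ := exists_measurableSet_measure_eq_half (α.restrict P)
  rw [Measure.restrict_apply hA, Measure.restrict_apply_univ] at hhalf
  have hhalf' : α (P \ A) = α P / 2 := by
    have h := measure_inter_add_sdiff (μ := α) P hA
    rw [Set.inter_comm, hhalf] at h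
    refine (ENNReal.add_right_inj (a := α P / 2) ?_).1 (h.trans (ENNReal.add_halves _).symm)
    exact (ENNReal.div_lt_top (measure_ne_top _ _) two_ne_zero).ne
  have hβ : β (P ∩ A) ≤ β P / 2 ∨ β (P \ A) ≤ β P / 2 := by
    by_contra! h
    have := ENNReal.add_lt_add h.1 h.2
    rw [ENNReal.add_halves, measure_inter_add_sdiff P hA] at this
    exact this.false
  rcases hβ with h | h
  · refine ⟨P \ A, Set.sdiff_subset, hP.diff hA, hhalf'.le, ?_⟩
    rwa [Set.sdiff_sdiff_right_self]
  · refine ⟨A ∩ P, Set.inter_subset_right, hA.inter hP, hhalf.le, ?_⟩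
    rwa [Set.sdiff_inter_self_eq_sdiff]

theorem exists_measure_le_half_on_fibers {κ : Type*} [Countable κ] [MeasurableSpace κ]
    [MeasurableSingletonClass κ] {r : Ω → κ} (hr : Measurable r) :
    ∃ Q, MeasurableSet Q ∧ ∀ V, α (r ⁻¹' V ∩ Q) ≤ α (r ⁻¹' V) / 2 ∧
      β (r ⁻¹' V \ Q) ≤ β (r ⁻¹' V) / 2 := by
  have hfiber (v : κ) : MeasurableSet (r ⁻¹' {v}) := hr (measurableSet_singleton v)
  choose Q hsub hQ hα hβ using fun v => exists_measure_le_half_measure_sdiff_le_half α β (hfiber v)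
  have hinter (v : κ) : r ⁻¹' {v} ∩ ⋃ w, Q w = Q v := by
    ext z
    simp only [Set.mem_inter_iff, Set.mem_iUnion]
    constructor
    · rintro ⟨hz, w, hw⟩
      exact hz.symm.trans (hsub w hw) ▸ hw
    · exact fun hz => ⟨hsub v hz, v, hz⟩
  refine ⟨⋃ v, Q v, .iUnion hQ, fun V =>
    ⟨measure_preimage_inter_le_half_of_singleton hr (fun v => ?_) V,
      measure_preimage_inter_le_half_of_singleton (S := (⋃ v, Q v)ᶜ) hr (fun v => ?_) V⟩⟩
  · rw [hinter]
    exact hα v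
  · rw [← Set.sdiff_eq, ← Set.sdiff_self_inter, hinter]
    exact hβ v

end Halving

section Thinning

variable {X : Type*} [MeasurableSpace X]

theorem nullSingletonClass_comap {Ω : Type*} [MeasurableSpace Ω] {f : Ω → X}
    (hf : MeasurableEmbedding f) (ν : Measure X) [NullSingletonClass ν] :
    NullSingletonClass (ν.comap f) :=
  ⟨fun p => by rw [hf.comap_apply, Set.image_singleton, measure_singleton]⟩

theorem exists_isClosed_subset_measure_le_two_mul [TopologicalSpace X] [PolishSpace X]
    [BorelSpace X] (ν : Measure X) [IsFiniteMeasure ν] (q : SimpleFunc X ℕ) {Y : Set X}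
    (hY : MeasurableSet Y) :
    ∃ K ⊆ Y, IsClosed K ∧ ∀ i, ν (q ⁻¹' {i} ∩ Y) ≤ 2 * ν (q ⁻¹' {i} ∩ K) := by
  have hcell (i : ℕ) : ∃ K ⊆ q ⁻¹' {i} ∩ Y, IsClosed K ∧ ν (q ⁻¹' {i} ∩ Y) ≤ 2 * ν K := by
    rcases eq_or_ne (ν (q ⁻¹' {i} ∩ Y)) 0 with h0 | h0
    · exact ⟨∅, Set.empty_subset _, isClosed_empty, by simp [h0]⟩
    obtain ⟨K, hKsub, hK, hlt⟩ := ((q.measurableSet_fiber i).inter hY).exists_lt_isCompact_of_ne_top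
      (measure_ne_top ν _) (ENNReal.half_lt_self h0 (measure_ne_top ν _))
    refine ⟨K, hKsub, hK.isClosed, ?_⟩
    rw [mul_comm, ← ENNReal.div_le_iff_le_mul (Or.inl two_ne_zero) (Or.inl ENNReal.ofNat_ne_top)]
    exact hlt.le
  choose K hKsub hK hle using hcell
  refine ⟨⋃ i ∈ q.range, K i, Set.iUnion₂_subset fun i _ => (hKsub i).trans Set.inter_subset_right,
    isClosed_biUnion_finset fun i _ => hK i, fun i => ?_⟩
  by_cases hi : i ∈ q.range
  · refine (hle i).trans (mul_le_mul_right (measure_mono ?_) 2)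
    exact Set.subset_inter ((hKsub i).trans Set.inter_subset_left)
      (Set.subset_biUnion_of_mem (u := K) hi)
  · rw [(q.preimage_eq_empty_iff i).2 hi]
    simp

theorem measure_inter_image_le_half {Ω : Type*} [MeasurableSpace Ω] {f : Ω → X}
    (hf : MeasurableEmbedding f) {ν : Measure X} {L : Set X} {Q : Set Ω}
    (h : ν.comap f (f ⁻¹' L ∩ Q) ≤ ν.comap f (f ⁻¹' L) / 2) :
    ν (L ∩ f '' Q) ≤ ν (L ∩ Set.range f) / 2 := by
  rwa [hf.comap_apply, hf.comap_apply, Set.image_preimage_inter,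
    Set.image_preimage_eq_inter_range] at h

theorem measure_le_two_mul_measure_inter_compl {ν : Measure X} [IsFiniteMeasure ν] {L S : Set X}
    (h : ν (L ∩ S) ≤ ν L / 2) : ν L ≤ 2 * ν (L ∩ Sᶜ) := by
  rw [mul_comm, ← ENNReal.div_le_iff_le_mul (Or.inl two_ne_zero) (Or.inl ENNReal.ofNat_ne_top)]
  calc ν L / 2 = ν L - ν L / 2 := (ENNReal.sub_half (measure_ne_top ν L)).symm
    _ ≤ ν L - ν (L ∩ S) := tsub_le_tsub_left h _
    _ ≤ ν (L \ (L ∩ S)) := le_measure_sdiff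
    _ = ν (L ∩ Sᶜ) := by rw [Set.sdiff_self_inter, Set.sdiff_eq]

variable (ν : Measure X) [IsFiniteMeasure ν] [NullSingletonClass ν]

theorem exists_disjoint_ranges_thinning {Ω κ : Type*} [MeasurableSpace Ω] [StandardBorelSpace Ω]
    {f g : Ω → X} (hf : MeasurableEmbedding f) (hg : MeasurableEmbedding g)
    (hfg : Disjoint (Set.range f) (Set.range g)) [Countable κ] [MeasurableSpace κ]
    [MeasurableSingletonClass κ] {q : X → κ} (hq : Measurable q) :
    ∃ Y, MeasurableSet Y ∧ (∀ p, f p ∈ Y → g p ∉ Y) ∧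
      ∀ V, ν (q ⁻¹' V) ≤ 2 * ν (q ⁻¹' V ∩ Y) := by
  have := nullSingletonClass_comap hf ν
  obtain ⟨Q, hQ, hle⟩ := exists_measure_le_half_on_fibers (ν.comap f) (ν.comap g)
    ((hq.comp hf.measurable).prodMk (hq.comp hg.measurable))
  have hfQ : MeasurableSet (f '' Q) := hf.measurableSet_image.2 hQ
  have hgQ : MeasurableSet (g '' Qᶜ) := hg.measurableSet_image.2 hQ.compl
  refine ⟨(f '' Q ∪ g '' Qᶜ)ᶜ, (hfQ.union hgQ).compl, fun p hfp hgp => ?_, fun V => ?_⟩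
  · by_cases hp : p ∈ Q
    · exact hfp (Or.inl ⟨p, hp, rfl⟩)
    · exact hgp (Or.inr ⟨p, hp, rfl⟩)
  set L := q ⁻¹' V
  have hfL : ν (L ∩ f '' Q) ≤ ν (L ∩ Set.range f) / 2 :=
    measure_inter_image_le_half hf (hle (Prod.fst ⁻¹' V)).1
  have hgL : ν (L ∩ g '' Qᶜ) ≤ ν (L ∩ Set.range g) / 2 :=
    measure_inter_image_le_half hg (hle (Prod.snd ⁻¹' V)).2
  have hranges : ν (L ∩ Set.range f) + ν (L ∩ Set.range g) ≤ ν L := by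
    rw [← measure_union (hfg.mono Set.inter_subset_right Set.inter_subset_right)
      ((hq V.to_countable.measurableSet).inter hg.measurableSet_range)]
    exact measure_mono (Set.union_subset Set.inter_subset_left Set.inter_subset_left)
  refine measure_le_two_mul_measure_inter_compl ?_
  calc ν (L ∩ (f '' Q ∪ g '' Qᶜ)) ≤ ν (L ∩ f '' Q) + ν (L ∩ g '' Qᶜ) := by
        rw [Set.inter_union_distrib_left]
        exact measure_union_le _ _
    _ ≤ ν (L ∩ Set.range f) / 2 + ν (L ∩ Set.range g) / 2 := add_le_add hfL hgL
    _ ≤ ν L / 2 := by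
        rw [← ENNReal.add_div]
        exact ENNReal.div_le_div_right hranges 2

variable [TopologicalSpace X] [PolishSpace X] [BorelSpace X]

theorem IsPartialInjection.exists_measurableSet_avoiding {T : Set (X × X)}
    (hT : IsPartialInjection T) {κ : Type*} [Countable κ] [MeasurableSpace κ]
    [MeasurableSingletonClass κ] {q : X → κ} (hq : Measurable q) :
    ∃ Y, MeasurableSet Y ∧ Disjoint (Y ×ˢ Y) T ∧ ∀ V, ν (q ⁻¹' V) ≤ 2 * ν (q ⁻¹' V ∩ Y) := by
  have := hT.measurableSet.standardBorel
  have hfst : MeasurableEmbedding fun p : T => p.1.1 :=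
    (measurable_fst.comp measurable_subtype_coe).measurableEmbedding
      fun p p' h => Subtype.ext (hT.injOn_fst p.2 p'.2 h)
  have hsnd : MeasurableEmbedding fun p : T => p.1.2 :=
    (measurable_snd.comp measurable_subtype_coe).measurableEmbedding
      fun p p' h => Subtype.ext (hT.injOn_snd p.2 p'.2 h)
  have hranges : Disjoint (Set.range fun p : T => p.1.1) (Set.range fun p : T => p.1.2) := by
    simpa only [Set.image_eq_range] using hT.disjoint_image
  obtain ⟨Y, hY, hTY, hle⟩ := exists_disjoint_ranges_thinning ν hfst hsnd hranges hq
  exact ⟨Y, hY, Set.disjoint_left.2 fun p hp hpT => hTY ⟨p, hpT⟩ hp.1 hp.2, hle⟩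

theorem IsPartialInjection.exists_isClosed_avoiding {T : Set (X × X)} (hT : IsPartialInjection T)
    (q : SimpleFunc X ℕ) :
    ∃ K, IsClosed K ∧ Disjoint (K ×ˢ K) T ∧ ∀ i, ν (q ⁻¹' {i}) ≤ 4 * ν (q ⁻¹' {i} ∩ K) := by
  obtain ⟨Y, hY, hYT, hYle⟩ := hT.exists_measurableSet_avoiding ν q.measurable
  obtain ⟨K, hKY, hK, hKle⟩ := exists_isClosed_subset_measure_le_two_mul ν q hY
  refine ⟨K, hK, hYT.mono_left (Set.prod_mono hKY hKY), fun i => ?_⟩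
  calc ν (q ⁻¹' {i}) ≤ 2 * ν (q ⁻¹' {i} ∩ Y) := hYle {i}
    _ ≤ 2 * (2 * ν (q ⁻¹' {i} ∩ K)) := by gcongr; exact hKle i
    _ = 4 * ν (q ⁻¹' {i} ∩ K) := by rw [← mul_assoc]; norm_num

end Thinning

section Concentration

variable {X : Type*} [MeasurableSpace X]

theorem exists_concentrated_measure_map_eq (ν : Measure X) [IsFiniteMeasure ν] {κ : Type*}
    [Countable κ] [MeasurableSpace κ] [MeasurableSingletonClass κ] {q : X → κ} (hq : Measurable q)
    {K : Set X} (hK : MeasurableSet K) {c : ℝ≥0∞}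
    (hle : ∀ i, ν (q ⁻¹' {i}) ≤ c * ν (q ⁻¹' {i} ∩ K)) :
    ∃ ν' : Measure X, ν' ≤ c • ν ∧ ν' Kᶜ = 0 ∧ ν'.map q = ν.map q := by
  let w : κ → ℝ≥0∞ := fun i => ν (q ⁻¹' {i}) / ν (q ⁻¹' {i} ∩ K)
  have hw (i : κ) : w i ≤ c := ENNReal.div_le_of_le_mul (hle i)
  have hfiber (i : κ) : MeasurableSet (q ⁻¹' {i}) := hq (measurableSet_singleton i)
  refine ⟨(ν.restrict K).withDensity (w ∘ q), ?_, ?_, ?_⟩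
  · calc (ν.restrict K).withDensity (w ∘ q) ≤ (ν.restrict K).withDensity (fun _ => c) :=
          withDensity_mono (ae_of_all _ fun x => hw (q x))
      _ = c • ν.restrict K := withDensity_const c
      _ ≤ c • ν := by gcongr; exact Measure.restrict_le_self
  · exact withDensity_absolutelyContinuous _ _ (by simp [Measure.restrict_apply hK.compl])
  · refine Measure.ext_of_singleton fun i => ?_
    have hzero : ν (q ⁻¹' {i} ∩ K) = 0 → ν (q ⁻¹' {i}) = 0 := fun h => by simpa [h] using hle i
    rw [Measure.map_apply hq (measurableSet_singleton i),
      Measure.map_apply hq (measurableSet_singleton i), withDensity_apply _ (hfiber i),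
      setLIntegral_congr_fun (f := w ∘ q) (g := fun _ => w i) (hfiber i)
        (fun x hx => congrArg w hx),
      setLIntegral_const, Measure.restrict_apply (hfiber i)]
    exact ENNReal.div_mul_cancel' hzero fun h => absurd h (measure_ne_top _ _)

variable [TopologicalSpace X] [PolishSpace X] [BorelSpace X]

theorem IsPartialInjection.exists_concentrated_measure {T : Set (X × X)}
    (hT : IsPartialInjection T) (q : SimpleFunc X ℕ) (ν : Measure X) [IsFiniteMeasure ν]
    [NullSingletonClass ν] :
    ∃ (ν' : Measure X) (K : Set X), IsClosed K ∧ Disjoint (K ×ˢ K) T ∧ ν' ≤ (4 : ℝ≥0∞) • ν ∧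
      ν' Kᶜ = 0 ∧ ν'.map q = ν.map q := by
  obtain ⟨K, hK, hKT, hle⟩ := hT.exists_isClosed_avoiding ν q
  obtain ⟨ν', hν', hν'K, hmap⟩ :=
    exists_concentrated_measure_map_eq ν q.measurable hK.measurableSet hle
  exact ⟨ν', K, hK, hKT, hν', hν'K, hmap⟩

theorem exists_concentrated_measure_sequence {T : ℕ → Set (X × X)}
    (hT : ∀ k, IsPartialInjection (T k)) {q : ℕ → SimpleFunc X ℕ}
    (hq : ∀ j k, j ≤ k → ∃ φ : ℕ → ℕ, ⇑(q j) = φ ∘ q k) (μ : Measure X) [IsFiniteMeasure μ]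
    [NullSingletonClass μ] :
    ∃ (ν : ℕ → Measure X) (K : ℕ → Set X),
      (∀ k, IsClosed (K k) ∧ Disjoint (K k ×ˢ K k) (T k)) ∧ ν 0 = μ ∧
      (∀ k, ν k ≤ (4 : ℝ≥0∞) ^ k • μ) ∧ (∀ j k, j < k → ν k (K j)ᶜ = 0) ∧
      ∀ j k, j ≤ k → (ν k).map (q j) = (ν j).map (q j) := by
  have hstep : ∀ k (ν : {ν : Measure X // ν ≤ (4 : ℝ≥0∞) ^ k • μ}),
      ∃ (ν' : {ν' : Measure X // ν' ≤ (4 : ℝ≥0∞) ^ (k + 1) • μ}) (K : Set X), IsClosed K ∧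
        Disjoint (K ×ˢ K) (T k) ∧ ν'.1 ≤ (4 : ℝ≥0∞) • ν.1 ∧ ν'.1 Kᶜ = 0 ∧
        ν'.1.map (q k) = ν.1.map (q k) := by
    rintro k ⟨ν, hν⟩
    have hfin : IsFiniteMeasure ((4 : ℝ≥0∞) ^ k • μ) := Measure.smul_finite μ (by finiteness)
    have := isFiniteMeasure_of_le _ hν
    have : NullSingletonClass ν := ⟨fun x =>
      le_zero_iff.1 ((hν {x}).trans_eq (by simp [measure_singleton]))⟩
    obtain ⟨ν', K, hK, hKT, hle, hν'K, hmap⟩ := (hT k).exists_concentrated_measure (q k) ν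
    have hν' : ν' ≤ (4 : ℝ≥0∞) ^ (k + 1) • μ := calc
      ν' ≤ (4 : ℝ≥0∞) • ν := hle
      _ ≤ (4 : ℝ≥0∞) • (4 : ℝ≥0∞) ^ k • μ := by gcongr
      _ = (4 : ℝ≥0∞) ^ (k + 1) • μ := by rw [smul_smul, pow_succ']
    exact ⟨⟨ν', hν'⟩, K, hK, hKT, hle, hν'K, hmap⟩
  choose nextMeasure K hK hKT hle hnull hmap using hstep
  let ν : ∀ k, {ν : Measure X // ν ≤ (4 : ℝ≥0∞) ^ k • μ} := fun k =>
    Nat.rec ⟨μ, by rw [pow_zero, one_smul]⟩ (fun k ν => nextMeasure k ν) k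
  refine ⟨fun k => (ν k).1, fun k => K k (ν k), fun k => ⟨hK k _, hKT k _⟩, rfl,
    fun k => (ν k).2, fun j k hjk => ?_, fun j k hjk => ?_⟩
  · induction k, hjk using Nat.le_induction with
    | base => exact hnull j (ν j)
    | succ k _ ih =>
      refine le_zero_iff.1 ((hle k (ν k) _).trans_eq ?_)
      rw [Measure.smul_apply, ih, smul_zero]
  · induction k, hjk using Nat.le_induction with
    | base => rfl
    | succ k hjk ih =>
      obtain ⟨φ, hφ⟩ := hq j k hjk
      have hφm : Measurable φ := measurable_from_top
      rw [← ih, hφ, ← Measure.map_map hφm (q k).measurable, ← Measure.map_map hφm (q k).measurable]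
      exact congrArg _ (hmap k (ν k))

end Concentration

section Partitions

variable {X : Type*} [PseudoEMetricSpace X] [MeasurableSpace X] [OpensMeasurableSpace X]
  [SecondCountableTopology X] {C : Set X}

theorem exists_simpleFunc_edist_le (hC : IsCompact C) {ε : ℝ≥0∞} (hε : ε ≠ 0) :
    ∃ q : SimpleFunc X ℕ, ∀ x ∈ C, ∀ y ∈ C, q x = q y → edist x y ≤ ε := by
  cases isEmpty_or_nonempty X
  · exact ⟨SimpleFunc.const X 0, fun x => isEmptyElim x⟩
  let e := TopologicalSpace.denseSeq X
  have hcover : C ⊆ ⋃ N, ⋃ k ≤ N, Metric.eball (e k) (ε / 2) := fun x _ => by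
    obtain ⟨k, hk⟩ := (TopologicalSpace.denseRange_denseSeq X).exists_mem_open
      (Metric.isOpen_eball (x := x)) ⟨x, Metric.mem_eball_self (ENNReal.half_pos hε)⟩
    exact Set.mem_iUnion.2 ⟨k, Set.mem_iUnion₂.2 ⟨k, le_rfl, Metric.mem_eball_comm.1 hk⟩⟩
  obtain ⟨N, hN⟩ := hC.elim_directed_cover _
    (fun N => isOpen_biUnion fun k _ => Metric.isOpen_eball) hcover
    (directed_of_isDirected_le fun N N' h =>
      Set.biUnion_subset_biUnion_left fun k hk => le_trans hk h)
  have hnear : ∀ x ∈ C, edist (SimpleFunc.nearestPt e N x) x ≤ ε / 2 := fun x hx => by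
    obtain ⟨k, hk, hxk⟩ := Set.mem_iUnion₂.1 (hN hx)
    exact (SimpleFunc.edist_nearestPt_le e x hk).trans ((edist_comm _ _).trans_le hxk.le)
  refine ⟨SimpleFunc.nearestPtInd e N, fun x hx y hy hxy => ?_⟩
  have hpt : SimpleFunc.nearestPt e N x = SimpleFunc.nearestPt e N y := congrArg e hxy
  calc edist x y ≤ edist (SimpleFunc.nearestPt e N x) x + edist (SimpleFunc.nearestPt e N x) y :=
        edist_triangle_left _ _ _
    _ ≤ ε / 2 + ε / 2 := add_le_add (hnear x hx) (hpt ▸ hnear y hy)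
    _ = ε := ENNReal.add_halves ε

theorem exists_refining_simpleFunc_edist_le (hC : IsCompact C) {ε : ℕ → ℝ≥0∞}
    (hε : ∀ k, ε k ≠ 0) :
    ∃ q : ℕ → SimpleFunc X ℕ, (∀ j k, j ≤ k → ∃ φ : ℕ → ℕ, ⇑(q j) = φ ∘ q k) ∧
      ∀ k, ∀ x ∈ C, ∀ y ∈ C, q k x = q k y → edist x y ≤ ε k := by
  choose r hr using fun k => exists_simpleFunc_edist_le hC (hε k)
  let q : ℕ → SimpleFunc X ℕ := fun k =>
    Nat.rec (r 0) (fun k q => (q.pair (r (k + 1))).map fun p => Nat.pair p.1 p.2) k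
  have hq (k : ℕ) (x : X) : q (k + 1) x = Nat.pair (q k x) (r (k + 1) x) := rfl
  refine ⟨q, fun j k hjk => ?_, fun k x hx y hy hxy => hr k x hx y hy ?_⟩
  · induction k, hjk using Nat.le_induction with
    | base => exact ⟨id, rfl⟩
    | succ k _ ih =>
      obtain ⟨φ, hφ⟩ := ih
      refine ⟨fun m => φ m.unpair.1, funext fun x => ?_⟩
      rw [Function.comp_apply, hq, Nat.unpair_pair, hφ, Function.comp_apply]
  · cases k with
    | zero => exact hxy
    | succ k => exact (Nat.pair_eq_pair.1 hxy).2

end Partitions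

section MassEstimate

theorem LowerOrder.exists_forall_mul_le {f g : ℝ≥0 → ℝ≥0} (hg : ∀ t, 0 < t → 0 < g t)
    (h : LowerOrder g f) (c : ℝ≥0) :
    ∃ δ : ℝ≥0, 0 < δ ∧ ∀ t, 0 < t → t < δ → c * f t ≤ g t := by
  have hlim : Tendsto (fun t => c * (f t / g t)) (𝓝[>] 0) (𝓝 0) := by
    simpa only [mul_zero] using Tendsto.const_mul c h
  obtain ⟨δ, hδ, hsub⟩ :=
    mem_nhdsGT_iff_exists_Ioo_subset.1 (hlim.eventually (ge_mem_nhds one_pos))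
  refine ⟨δ, hδ, fun t ht htδ => ?_⟩
  have hle : c * (f t / g t) ≤ 1 := hsub ⟨ht, htδ⟩
  rwa [← mul_div_assoc, div_le_one (hg t ht)] at hle

theorem LowerOrder.exists_scales {f g : ℝ≥0 → ℝ≥0} (hg : ∀ t, 0 < t → 0 < g t)
    (h : LowerOrder g f) (c : ℕ → ℝ≥0) :
    ∃ ε : ℕ → ℝ≥0, (∀ k, 0 < ε k) ∧ Tendsto ε atTop (𝓝 0) ∧
      ∀ k t, 0 < t → t < ε k → c k * f t ≤ g t := by
  choose δ hδ hle using fun k => h.exists_forall_mul_le hg (c k)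
  refine ⟨fun k => min (δ k) (1 / (k + 1)), fun k => lt_min (hδ k) (by positivity), ?_,
    fun k t ht htk => hle k t ht (htk.trans_le (min_le_left _ _))⟩
  exact tendsto_of_tendsto_of_tendsto_of_le_of_le tendsto_const_nhds
    tendsto_one_div_add_atTop_nhds_zero_nat (fun k => zero_le) fun k => min_le_right _ _

variable {X : Type*} [PseudoEMetricSpace X] [MeasurableSpace X]

/-- The Frostman condition of exponent `s`: `μ U` is at most a fixed multiple of `(diam U) ^ s`.
For Lebesgue measure on `ℝⁿ` this holds with `s = n`. -/
def IsFrostman (s : ℝ≥0) (μ : Measure X) : Prop :=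
  ∃ c : ℝ≥0, ∀ U, μ U ≤ c * Metric.ediam U ^ (s : ℝ)

variable {μ : Measure X} {s c : ℝ≥0} {C : Set X}

theorem IsFrostman.mono {ν : Measure X} (hμ : IsFrostman s μ) (hν : ν ≤ μ) : IsFrostman s ν :=
  hμ.imp fun _ hc U => (hν U).trans (hc U)

theorem measure_preimage_image_le (hμ : ∀ U, μ U ≤ c * Metric.ediam U ^ (s : ℝ))
    (hμC : μ Cᶜ = 0) {κ : Type*} {q : X → κ} {ε : ℝ≥0}
    (hq : ∀ x ∈ C, ∀ y ∈ C, q x = q y → edist x y ≤ ε) {U : Set X} (hU : ε ≤ Metric.ediam U) :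
    μ (q ⁻¹' (q '' (U ∩ C))) ≤ c * (3 * Metric.ediam U) ^ (s : ℝ) := by
  have hsub : q ⁻¹' (q '' (U ∩ C)) ∩ C ⊆ Metric.cthickening ε U := by
    rintro y ⟨⟨x, ⟨hxU, hxC⟩, hxy⟩, hyC⟩
    refine Metric.mem_cthickening_of_edist_le y x ε U hxU ?_
    rw [ENNReal.ofReal_coe_nnreal]
    exact hq y hyC x hxC hxy.symm
  have hdiam : Metric.ediam (Metric.cthickening ε U) ≤ 3 * Metric.ediam U := calc
    _ ≤ Metric.ediam U + 2 * ε := Metric.ediam_cthickening_le ε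
    _ ≤ Metric.ediam U + 2 * Metric.ediam U := by gcongr
    _ = 3 * Metric.ediam U := by ring
  calc μ (q ⁻¹' (q '' (U ∩ C))) = μ (q ⁻¹' (q '' (U ∩ C)) ∩ C) :=
        (measure_inter_conull hμC).symm
    _ ≤ μ (Metric.cthickening ε U) := measure_mono hsub
    _ ≤ c * Metric.ediam (Metric.cthickening ε U) ^ (s : ℝ) := hμ _
    _ ≤ c * (3 * Metric.ediam U) ^ (s : ℝ) := by gcongr

theorem exists_scale_le {ε : ℕ → ℝ≥0} (hε : Tendsto ε atTop (𝓝 0)) {d : ℝ≥0} (hd : 0 < d)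
    (hdε : d < ε 0) : ∃ j, d < ε j ∧ ε (j + 1) ≤ d := by
  by_contra! h
  have hlt : ∀ j, d < ε j := fun j => by
    induction j with
    | zero => exact hdε
    | succ j ih => exact h j ih
  exact hd.not_ge (ge_of_tendsto' hε fun j => (hlt j).le)

theorem measure_le_pow_mul_of_map_eq (hμ : ∀ U, μ U ≤ c * Metric.ediam U ^ (s : ℝ))
    (hμC : μ Cᶜ = 0) {q : ℕ → SimpleFunc X ℕ} {ν : ℕ → Measure X}
    (hν : ∀ k, ν k ≤ (4 : ℝ≥0∞) ^ k • μ)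
    (hmap : ∀ j k, j ≤ k → (ν k).map (q j) = (ν j).map (q j)) {j : ℕ} {ε : ℝ≥0}
    (hq : ∀ x ∈ C, ∀ y ∈ C, q j x = q j y → edist x y ≤ ε) (k : ℕ) {U : Set X}
    (hU : ε ≤ Metric.ediam U) :
    ν k U ≤ 4 ^ j * (c * (3 * Metric.ediam U) ^ (s : ℝ)) := by
  have hνle (k : ℕ) (V : Set X) : ν k V ≤ 4 ^ k * μ V := hν k V
  -- From stage `j` on, the masses of the cells of `q j` no longer change; before it, the density
  -- bound is good enough.
  rcases le_total j k with hjk | hkj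
  · have hνC : ν k Cᶜ = 0 := le_zero_iff.1 ((hνle k _).trans_eq (by rw [hμC, mul_zero]))
    calc ν k U = ν k (U ∩ C) := (measure_inter_conull hνC).symm
      _ ≤ ν k (q j ⁻¹' (q j '' (U ∩ C))) := measure_mono (Set.subset_preimage_image _ _)
      _ = ν j (q j ⁻¹' (q j '' (U ∩ C))) := by
        rw [← Measure.map_apply (q j).measurable .of_discrete, hmap j k hjk,
          Measure.map_apply (q j).measurable .of_discrete]
      _ ≤ 4 ^ j * μ (q j ⁻¹' (q j '' (U ∩ C))) := hνle j _
      _ ≤ 4 ^ j * (c * (3 * Metric.ediam U) ^ (s : ℝ)) := by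
        gcongr
        exact measure_preimage_image_le hμ hμC hq hU
  · calc ν k U ≤ 4 ^ k * μ U := hνle k U
      _ ≤ 4 ^ j * (c * Metric.ediam U ^ (s : ℝ)) := by gcongr; exacts [by norm_num, hμ U]
      _ ≤ 4 ^ j * (c * (3 * Metric.ediam U) ^ (s : ℝ)) := by
        gcongr
        exact le_mul_of_one_le_left' (by norm_num)

theorem measure_le_gauge_ediam_of_map_eq (hs : s ≠ 0)
    (hμ : ∀ U, μ U ≤ c * Metric.ediam U ^ (s : ℝ)) (hμC : μ Cᶜ = 0) {g : ℝ≥0 → ℝ≥0}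
    {ε : ℕ → ℝ≥0} (hε : Tendsto ε atTop (𝓝 0))
    (hg : ∀ k t, 0 < t → t < ε k → 4 ^ k * t ^ (s : ℝ) ≤ g t) {q : ℕ → SimpleFunc X ℕ}
    (hq : ∀ k, ∀ x ∈ C, ∀ y ∈ C, q k x = q k y → edist x y ≤ ε (k + 1)) {ν : ℕ → Measure X}
    (hν : ∀ k, ν k ≤ (4 : ℝ≥0∞) ^ k • μ)
    (hmap : ∀ j k, j ≤ k → (ν k).map (q j) = (ν j).map (q j)) (k : ℕ) {U : Set X}
    (hU : Metric.ediam U < ε 0) :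
    ν k U ≤ c * 3 ^ (s : ℝ) * g (Metric.ediam U).toNNReal := by
  lift Metric.ediam U to ℝ≥0 using hU.ne_top with d hd
  rw [ENNReal.toNNReal_coe]
  rcases eq_zero_or_pos d with rfl | hd0
  · have hμU : μ U = 0 := le_zero_iff.1 ((hμ U).trans_eq (by
      rw [← hd, ENNReal.coe_zero, ENNReal.zero_rpow_of_pos (by positivity), mul_zero]))
    have hνU : ν k U = 0 := le_zero_iff.1 ((hν k U).trans_eq (by
      rw [Measure.smul_apply, hμU, smul_zero]))
    exact hνU.trans_le zero_le
  obtain ⟨j, hdj, hjd⟩ := exists_scale_le hε hd0 (ENNReal.coe_lt_coe.1 hU)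
  have hgd : (4 : ℝ≥0∞) ^ j * (d : ℝ≥0∞) ^ (s : ℝ) ≤ g d := by
    rw [← ENNReal.coe_rpow_of_nonneg _ s.coe_nonneg]
    exact_mod_cast hg j d hd0 hdj
  calc ν k U ≤ 4 ^ j * (c * (3 * Metric.ediam U) ^ (s : ℝ)) :=
        measure_le_pow_mul_of_map_eq hμ hμC hν hmap (hq j) k (hd ▸ ENNReal.coe_le_coe.2 hjd)
    _ = c * 3 ^ (s : ℝ) * (4 ^ j * (d : ℝ≥0∞) ^ (s : ℝ)) := by
        rw [← hd, ENNReal.mul_rpow_of_nonneg _ _ s.coe_nonneg]; ring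
    _ ≤ c * 3 ^ (s : ℝ) * g d := by gcongr

end MassEstimate

section Transversal

theorem div_le_gaugePreMeasure_iInter {X : Type*} [EMetricSpace X] [MeasurableSpace X]
    {A : ℕ → Set X} (hA : ∀ l, IsCompact (A l)) (hanti : Antitone A) {ν : ℕ → Measure X}
    {m M : ℝ≥0∞} (hm : ∀ l, m ≤ ν l (A l)) {g : ℝ≥0 → ℝ≥0} {δ : ℝ≥0}
    (hν : ∀ l U, Metric.ediam U < δ → ν l U ≤ M * g (Metric.ediam U).toNNReal) :
    m / M ≤ gaugePreMeasure g δ (⋂ l, A l) := by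
  refine le_iInf fun U => le_iInf fun hU => le_iInf fun hAU => le_iInf fun hUδ => ?_
  obtain ⟨l, hl⟩ : ∃ l, A l ⊆ ⋃ i, U i := exists_subset_nhds_of_isCompact
    (directed_of_isDirected_le hanti) hA fun x hx => (isOpen_iUnion hU).mem_nhds (hAU hx)
  refine ENNReal.div_le_of_le_mul' ?_
  calc m ≤ ν l (A l) := hm l
    _ ≤ ν l (⋃ i, U i) := measure_mono hl
    _ ≤ ∑' i, ν l (U i) := measure_iUnion_le _
    _ ≤ ∑' i, M * g (Metric.ediam (U i)).toNNReal :=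
      ENNReal.tsum_le_tsum fun i => hν l (U i) (hUδ i)
    _ = M * ∑' i, (g (Metric.ediam (U i)).toNNReal : ℝ≥0∞) := ENNReal.tsum_mul_left

theorem measure_inter_biInter_eq {X : Type*} [MeasurableSpace X] {ν : Measure X} {C : Set X}
    (hC : ν Cᶜ = 0) {K : ℕ → Set X} {l : ℕ} (hK : ∀ k < l, ν (K k)ᶜ = 0) :
    ν (C ∩ ⋂ k < l, K k) = ν Set.univ := by
  refine measure_congr (ae_eq_univ.2 ?_)
  rw [Set.compl_inter, Set.compl_iInter₂]
  exact measure_union_null hC ((measure_biUnion_null_iff (Set.to_countable _)).2 hK)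

variable {X : Type*} [EMetricSpace X] [MeasurableSpace X] {μ : Measure X} {s : ℝ≥0}

theorem IsFrostman.nullSingletonClass (hμ : IsFrostman s μ) (hs : s ≠ 0) :
    NullSingletonClass μ := by
  obtain ⟨c, hc⟩ := hμ
  refine ⟨fun x => le_zero_iff.1 ((hc {x}).trans_eq ?_)⟩
  rw [Metric.ediam_singleton, ENNReal.zero_rpow_of_pos (by positivity), mul_zero]

variable [PolishSpace X] [BorelSpace X] {g : ℝ≥0 → ℝ≥0}

theorem IsFrostman.exists_isCompact_avoiding (hμ : IsFrostman s μ) (hs : s ≠ 0)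
    (hg : ∀ t, 0 < t → 0 < g t) (hlow : LowerOrder g fun t => t ^ (s : ℝ)) {T : ℕ → Set (X × X)}
    (hT : ∀ k, IsPartialInjection (T k)) {C : Set X} (hC : IsCompact C) (hμC : μ C ≠ 0)
    (hμC' : μ C ≠ ⊤) :
    ∃ A ⊆ C, IsCompact A ∧ (∀ k, Disjoint (A ×ˢ A) (T k)) ∧
      ∃ δ : ℝ≥0, 0 < δ ∧ 0 < gaugePreMeasure g δ A := by
  obtain ⟨c, hc⟩ := hμ.mono (Measure.restrict_le_self (s := C))
  have := hμ.nullSingletonClass hs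
  have : IsFiniteMeasure (μ.restrict C) := isFiniteMeasure_restrict.2 hμC'
  have hnull : μ.restrict C Cᶜ = 0 := by
    rw [Measure.restrict_apply hC.measurableSet.compl, Set.compl_inter_self, measure_empty]
  obtain ⟨ε, hε, hε0, hεg⟩ := hlow.exists_scales hg fun k => 4 ^ k
  obtain ⟨q, hqφ, hq⟩ := exists_refining_simpleFunc_edist_le hC (ε := fun k => ε (k + 1))
    fun k => ENNReal.coe_ne_zero.2 (hε _).ne'
  obtain ⟨ν, K, hK, hν0, hν, hνK, hmap⟩ := exists_concentrated_measure_sequence hT hqφ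
    (μ.restrict C)
  let A : ℕ → Set X := fun l => C ∩ ⋂ k < l, K k
  have hA (l : ℕ) : IsCompact (A l) :=
    hC.inter_right (isClosed_biInter fun k _ => (hK k).1)
  have hanti : Antitone A := fun l l' h => Set.inter_subset_inter_right _
    (Set.biInter_subset_biInter_left fun k hk => lt_of_lt_of_le hk h)
  have hmass (l : ℕ) : μ C = ν l (A l) := calc
    μ C = ν 0 Set.univ := by rw [hν0, Measure.restrict_apply_univ]
    _ = ν l Set.univ := by
      simpa only [Measure.map_apply (q 0).measurable .univ, Set.preimage_univ] using
        congrArg (fun ν' => ν' Set.univ) (hmap 0 l l.zero_le).symm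
    _ = ν l (A l) := (measure_inter_biInter_eq (le_zero_iff.1 ((hν l _).trans_eq (by
        rw [Measure.smul_apply, hnull, smul_zero]))) fun k hk => hνK k l hk).symm
  refine ⟨⋂ l, A l, (Set.iInter_subset _ 0).trans Set.inter_subset_left,
    (hA 0).of_isClosed_subset (isClosed_iInter fun l => (hA l).isClosed) (Set.iInter_subset _ 0),
    fun k => ?_, ε 0, hε 0, ?_⟩
  · have hsub : ⋂ l, A l ⊆ K k := (Set.iInter_subset _ (k + 1)).trans
      (Set.inter_subset_right.trans (Set.biInter_subset_of_mem k.lt_succ_self))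
    exact (hK k).2.mono_left (Set.prod_mono hsub hsub)
  · have hM : (c : ℝ≥0∞) * 3 ^ (s : ℝ) ≠ ⊤ := by finiteness
    exact (ENNReal.div_pos hμC hM).trans_le (div_le_gaugePreMeasure_iInter hA hanti
      (fun l => (hmass l).le) fun l U => measure_le_gauge_ediam_of_map_eq hs hc hnull hε0 hεg hq
        hν hmap l)

theorem IsCountableBorel.exists_isCompact_transversal {E : Setoid X} (hE : IsCountableBorel E)
    (hμ : IsFrostman s μ) (hs : s ≠ 0) (hg : ∀ t, 0 < t → 0 < g t)
    (hlow : LowerOrder g fun t => t ^ (s : ℝ)) {B : Set X} (hB : MeasurableSet B)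
    (hμB : μ B ≠ 0) (hμB' : μ B ≠ ⊤) :
    ∃ A ⊆ B, IsCompact A ∧ A.Pairwise (fun x y => ¬ E x y) ∧
      ∃ δ : ℝ≥0, 0 < δ ∧ 0 < gaugePreMeasure g δ A := by
  have : IsFiniteMeasure (μ.restrict B) := isFiniteMeasure_restrict.2 hμB'
  obtain ⟨T, hT, G, hG, hμG, hGT⟩ := hE.exists_partialInjections (μ.restrict B)
  have hBG : μ (B ∩ G) = μ B := by
    rw [Set.inter_comm, ← Measure.restrict_apply hG, measure_congr (ae_eq_univ.2 hμG),
      Measure.restrict_apply_univ]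
  obtain ⟨C, hCB, hC, hμC⟩ := (hB.inter hG).exists_lt_isCompact_of_ne_top (hBG ▸ hμB')
    (pos_iff_ne_zero.2 (hBG ▸ hμB))
  obtain ⟨A, hAC, hA, hAT, hpos⟩ := hμ.exists_isCompact_avoiding hs hg hlow hT hC hμC.ne'
    (measure_ne_top_of_subset (hCB.trans Set.inter_subset_left) hμB')
  refine ⟨A, hAC.trans (hCB.trans Set.inter_subset_left), hA, fun x hx y hy hne hxy => ?_, hpos⟩
  obtain ⟨k, hk | hk⟩ := hGT x (hCB (hAC hx)).2 y (hCB (hAC hy)).2 hxy hne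
  · exact Set.disjoint_left.1 (hAT k) ⟨hx, hy⟩ hk
  · exact Set.disjoint_left.1 (hAT k) ⟨hy, hx⟩ hk

end Transversal

section Dimension

theorem exists_isOpen_superset_rpow_ediam_le {X : Type*} [PseudoEMetricSpace X] {S : Set X}
    {δ : ℝ≥0∞} (hδ : Metric.ediam S < δ) {r : ℝ} (hr : 0 ≤ r) {η : ℝ≥0∞} (hη : η ≠ 0) :
    ∃ U, IsOpen U ∧ S ⊆ U ∧ Metric.ediam U < δ ∧ Metric.ediam U ^ r ≤ Metric.ediam S ^ r + η := by
  have hlim : Tendsto (fun ε : ℝ≥0 => Metric.ediam S + 2 * ε) (𝓝[>] 0) (𝓝 (Metric.ediam S)) := by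
    have hcont : Continuous fun ε : ℝ≥0 => Metric.ediam S + 2 * (ε : ℝ≥0∞) :=
      continuous_const.add ((ENNReal.continuous_const_mul ENNReal.ofNat_ne_top).comp
        ENNReal.continuous_coe)
    exact (hcont.tendsto' 0 _ (by simp)).mono_left nhdsWithin_le_nhds
  have hlt : Metric.ediam S ^ r < Metric.ediam S ^ r + η :=
    ENNReal.lt_add_right (ENNReal.rpow_ne_top_of_nonneg hr hδ.ne_top) hη
  obtain ⟨ε, ⟨hεδ, hεη⟩, hε⟩ := ((hlim.eventually (gt_mem_nhds hδ)).and
    ((hlim.ennrpow_const r).eventually (gt_mem_nhds hlt))).and self_mem_nhdsWithin |>.exists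
  have hdiam := Metric.ediam_thickening_le (s := S) ε
  exact ⟨Metric.thickening ε S, Metric.isOpen_thickening,
    Metric.self_subset_thickening (NNReal.coe_pos.2 hε) S, hdiam.trans_lt hεδ,
    (ENNReal.rpow_le_rpow hdiam hr).trans hεη.le⟩

theorem gaugePreMeasure_le_tsum_rpow_ediam {X : Type*} [PseudoEMetricSpace X] {g : ℝ≥0 → ℝ≥0}
    {δ : ℝ≥0} {r : ℝ} (hr : 0 ≤ r) (hg : ∀ t < δ, g t ≤ t ^ r) {A : Set X} {S : ℕ → Set X}
    (hA : A ⊆ ⋃ i, S i) (hS : ∀ i, Metric.ediam (S i) < δ) :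
    gaugePreMeasure g δ A ≤ ∑' i, Metric.ediam (S i) ^ r := by
  refine ENNReal.le_of_forall_pos_le_add fun η hη _ => ?_
  obtain ⟨e, he, hesum⟩ := ENNReal.exists_pos_sum_of_countable (ENNReal.coe_ne_zero.2 hη.ne') ℕ
  choose U hU hSU hUδ hUe using fun i =>
    exists_isOpen_superset_rpow_ediam_le (hS i) hr (ENNReal.coe_ne_zero.2 (he i).ne')
  have hgU (i : ℕ) : (g (Metric.ediam (U i)).toNNReal : ℝ≥0∞) ≤ Metric.ediam (U i) ^ r := by
    lift Metric.ediam (U i) to ℝ≥0 using (hUδ i).ne_top with d hd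
    rw [ENNReal.toNNReal_coe, ← ENNReal.coe_rpow_of_nonneg _ hr]
    exact ENNReal.coe_le_coe.2 (hg d (ENNReal.coe_lt_coe.1 (hd ▸ hUδ i)))
  calc gaugePreMeasure g δ A ≤ ∑' i, (g (Metric.ediam (U i)).toNNReal : ℝ≥0∞) :=
        iInf_le_of_le U <| iInf_le_of_le hU <|
          iInf_le_of_le (hA.trans (Set.iUnion_mono hSU)) <| iInf_le_of_le hUδ le_rfl
    _ ≤ ∑' i, (Metric.ediam (S i) ^ r + e i) :=
        ENNReal.tsum_le_tsum fun i => (hgU i).trans (hUe i)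
    _ = ∑' i, Metric.ediam (S i) ^ r + ∑' i, (e i : ℝ≥0∞) := ENNReal.tsum_add
    _ ≤ ∑' i, Metric.ediam (S i) ^ r + η := by gcongr

theorem gaugePreMeasure_le_hausdorffMeasure {X : Type*} [EMetricSpace X] [MeasurableSpace X]
    [BorelSpace X] {g : ℝ≥0 → ℝ≥0} {δ : ℝ≥0} (hδ : 0 < δ) {r : ℝ} (hr : 0 < r)
    (hg : ∀ t < δ, g t ≤ t ^ r) (A : Set X) :
    gaugePreMeasure g δ A ≤ Measure.hausdorffMeasure r A := by
  rw [Measure.hausdorffMeasure_apply]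
  refine le_iSup₂_of_le (δ / 2 : ℝ≥0∞) (ENNReal.half_pos (ENNReal.coe_ne_zero.2 hδ.ne')) ?_
  refine le_iInf fun S => le_iInf fun hA => le_iInf fun hS => ?_
  refine (gaugePreMeasure_le_tsum_rpow_ediam hr.le hg hA fun i => (hS i).trans_lt
    (ENNReal.half_lt_self (ENNReal.coe_ne_zero.2 hδ.ne') ENNReal.coe_ne_top)).trans
      (ENNReal.tsum_le_tsum fun i => ?_)
  rcases (S i).eq_empty_or_nonempty with hSi | hSi
  · rw [hSi, Metric.ediam_empty, ENNReal.zero_rpow_of_pos hr]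
    exact zero_le
  · rw [iSup_pos hSi]

theorem gaugePreMeasure_antitone {X : Type*} [PseudoEMetricSpace X] (g : ℝ≥0 → ℝ≥0) (A : Set X) :
    Antitone fun δ => gaugePreMeasure g δ A := fun _ _ h =>
  iInf_mono fun _ => iInf_mono fun _ => iInf_mono fun _ => iInf_mono' fun hU =>
    ⟨fun i => (hU i).trans_le (ENNReal.coe_le_coe.2 h), le_rfl⟩

theorem le_dimH_of_gaugePreMeasure_pos {X : Type*} [EMetricSpace X] {g : ℝ≥0 → ℝ≥0}
    (hg0 : g 0 = 0) {s : ℝ≥0} (hg : ∀ r < s, ∀ᶠ t in 𝓝[>] (0 : ℝ≥0), g t ≤ t ^ (r : ℝ))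
    {A : Set X} {δ : ℝ≥0} (hδ : 0 < δ) (hA : 0 < gaugePreMeasure g δ A) : s ≤ dimH A := by
  borelize X
  refine ENNReal.le_of_forall_nnreal_lt fun r hrs => ?_
  rcases eq_zero_or_pos r with rfl | hr
  · exact zero_le
  obtain ⟨ρ, hρ, hsub⟩ := mem_nhdsGT_iff_exists_Ioo_subset.1 (hg r (ENNReal.coe_lt_coe.1 hrs))
  refine le_dimH_of_hausdorffMeasure_ne_zero (hA.trans_le ?_).ne'
  calc gaugePreMeasure g δ A ≤ gaugePreMeasure g (min δ ρ) A :=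
        gaugePreMeasure_antitone g A (min_le_left δ ρ)
    _ ≤ Measure.hausdorffMeasure r A :=
        gaugePreMeasure_le_hausdorffMeasure (lt_min hδ hρ) hr (fun t ht => ?_) A
  rcases eq_zero_or_pos t with rfl | ht0
  · exact hg0.trans_le zero_le
  · exact hsub ⟨ht0, ht.trans_le (min_le_right δ ρ)⟩

/-- The function `t ^ s (1 + |log t|)`: near `0` it is larger than every multiple of `t ^ s`, and
smaller than `t ^ r` for each `r < s`, so that it detects the dimension `s`. -/
noncomputable def logGauge (s t : ℝ≥0) : ℝ≥0 :=
  t ^ (s : ℝ) * (1 + Real.nnabs (Real.log t))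

theorem logGauge_zero {s : ℝ≥0} (hs : s ≠ 0) : logGauge s 0 = 0 := by
  rw [logGauge, NNReal.zero_rpow (NNReal.coe_ne_zero.2 hs), zero_mul]

theorem logGauge_pos (s : ℝ≥0) {t : ℝ≥0} (ht : 0 < t) : 0 < logGauge s t :=
  mul_pos (NNReal.rpow_pos ht) (add_pos_of_pos_of_nonneg one_pos zero_le)

theorem tendsto_nnreal_coe_nhdsGT_zero : Tendsto (fun t : ℝ≥0 => (t : ℝ)) (𝓝[>] 0) (𝓝[>] 0) :=
  tendsto_nhdsWithin_iff.2 ⟨(NNReal.continuous_coe.tendsto' 0 0 rfl).mono_left nhdsWithin_le_nhds,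
    eventually_mem_nhdsWithin.mono fun _ ht => NNReal.coe_pos.2 ht⟩

theorem lowerOrder_logGauge (s : ℝ≥0) : LowerOrder (logGauge s) fun t => t ^ (s : ℝ) := by
  have hlog : Tendsto (fun t : ℝ≥0 => 1 + Real.nnabs (Real.log t)) (𝓝[>] 0) atTop := by
    rw [← NNReal.tendsto_coe_atTop]
    exact tendsto_atTop_add_const_left _ _ (tendsto_abs_atBot_atTop.comp
      (Real.tendsto_log_nhdsGT_zero.comp tendsto_nnreal_coe_nhdsGT_zero))
  refine hlog.inv_tendsto_atTop.congr' ?_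
  filter_upwards [self_mem_nhdsWithin] with t ht
  rw [logGauge, Pi.inv_apply, div_mul_cancel_left₀ (NNReal.rpow_pos ht).ne']

theorem eventually_logGauge_le {r s : ℝ≥0} (hrs : r < s) :
    ∀ᶠ t in 𝓝[>] (0 : ℝ≥0), logGauge s t ≤ t ^ (r : ℝ) := by
  have hpos : (0 : ℝ) < s - r := sub_pos.2 (NNReal.coe_lt_coe.2 hrs)
  have hlim : Tendsto (fun t : ℝ => t ^ ((s : ℝ) - r) + |Real.log t * t ^ ((s : ℝ) - r)|)
      (𝓝[>] 0) (𝓝 (0 + |0|)) :=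
    (((Real.continuous_rpow_const hpos.le).tendsto' 0 0 (Real.zero_rpow hpos.ne')).mono_left
      nhdsWithin_le_nhds).add (tendsto_log_mul_rpow_nhdsGT_zero hpos).abs
  rw [abs_zero, add_zero] at hlim
  filter_upwards [(hlim.comp tendsto_nnreal_coe_nhdsGT_zero).eventually (ge_mem_nhds one_pos),
    self_mem_nhdsWithin] with t hle ht
  have ht : 0 < (t : ℝ) := NNReal.coe_pos.2 ht
  rw [← NNReal.coe_le_coe]
  calc ((logGauge s t : ℝ≥0) : ℝ) = (t : ℝ) ^ (s : ℝ) * (1 + |Real.log t|) := rfl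
    _ = (t : ℝ) ^ (r : ℝ) * (t ^ ((s : ℝ) - r) + |Real.log t * t ^ ((s : ℝ) - r)|) := by
      rw [abs_mul, abs_of_pos (Real.rpow_pos_of_pos ht _), ← one_add_mul, mul_comm (1 + _),
        ← mul_assoc, ← Real.rpow_add ht, add_sub_cancel]
    _ ≤ (t : ℝ) ^ (r : ℝ) := mul_le_of_le_one_right (by positivity) hle
    _ = ((t ^ (r : ℝ) : ℝ≥0) : ℝ) := rfl

end Dimension

theorem isSmooth_restrictSetoid {X : Type*} [MeasurableSpace X] [StandardBorelSpace X]
    {E : Setoid X} {A : Set X} (hA : A.Pairwise fun x y => ¬ E x y) :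
    IsSmooth (restrictSetoid E A) := by
  refine ⟨fun x => embeddingReal X x, (measurable_embeddingReal X).comp measurable_subtype_coe,
    fun x y => ⟨fun h => congrArg (embeddingReal X) ?_, fun h => ?_⟩⟩
  · exact hA.eq x.2 y.2 (not_not.2 h)
  · have hxy : x = y := Subtype.ext ((measurableEmbedding_embeddingReal X).injective h)
    exact hxy ▸ (restrictSetoid E A).refl x

theorem IsGauge.not_lowerOrder_const {g : ℝ≥0 → ℝ≥0} (hg : IsGauge g) {c : ℝ≥0} (hc : c ≠ 0) :
    ¬ LowerOrder g fun _ => c := by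
  intro hlow
  have hg0 : Tendsto g (𝓝[>] 0) (𝓝 0) := by
    simpa only [ContinuousWithinAt, hg.map_zero] using
      (hg.rightContinuous 0).mono Set.Ioi_subset_Ici_self
  have hmul : Tendsto (fun t => g t * (c / g t)) (𝓝[>] 0) (𝓝 0) := by
    simpa only [mul_zero] using hg0.mul hlow
  refine hc (tendsto_nhds_unique (tendsto_const_nhds.congr' ?_) hmul)
  filter_upwards [self_mem_nhdsWithin] with t ht
  exact (mul_div_cancel₀ c (hg.pos t ht).ne').symm

theorem corollary4p3_general {X : Type*} [EMetricSpace X] [PolishSpace X] [MeasurableSpace X]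
    [BorelSpace X] {E : Setoid X} (hE : IsCountableBorel E) {μ : Measure X} {s : ℝ≥0}
    (hμ : IsFrostman s μ) {B : Set X} (hB : MeasurableSet B) (hμB : μ B ≠ 0) (hμB' : μ B ≠ ⊤) :
    (∀ g, IsGauge g → LowerOrder g (fun t => t ^ (s : ℝ)) →
      ∃ A ⊆ B, IsCompact A ∧ IsSmooth (restrictSetoid E A) ∧ 0 < gaugeMeasure g A) ∧
    ∃ A ⊆ B, IsCompact A ∧ IsSmooth (restrictSetoid E A) ∧ s ≤ dimH A := by
  rcases eq_or_ne s 0 with rfl | hs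
  · obtain ⟨x, hx⟩ := nonempty_of_measure_ne_zero hμB
    refine ⟨fun g hg hlow => ?_, {x}, Set.singleton_subset_iff.2 hx, isCompact_singleton,
      isSmooth_restrictSetoid (Set.pairwise_singleton _ _), zero_le⟩
    simp only [NNReal.coe_zero, NNReal.rpow_zero] at hlow
    exact absurd hlow (hg.not_lowerOrder_const one_ne_zero)
  · refine ⟨fun g hg hlow => ?_, ?_⟩
    · obtain ⟨A, hAB, hA, hAE, δ, hδ, hpos⟩ :=
        hE.exists_isCompact_transversal hμ hs hg.pos hlow hB hμB hμB'
      exact ⟨A, hAB, hA, isSmooth_restrictSetoid hAE,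
        hpos.trans_le (le_iSup₂ (f := fun δ (_ : 0 < δ) => gaugePreMeasure g δ A) δ hδ)⟩
    · obtain ⟨A, hAB, hA, hAE, δ, hδ, hpos⟩ := hE.exists_isCompact_transversal hμ hs
        (fun t => logGauge_pos s) (lowerOrder_logGauge s) hB hμB hμB'
      exact ⟨A, hAB, hA, isSmooth_restrictSetoid hAE,
        le_dimH_of_gaugePreMeasure_pos (logGauge_zero hs) (fun r => eventually_logGauge_le) hδ hpos⟩

section UnitCube

theorem volume_le_ediam_pow {ι : Type*} [Fintype ι] (U : Set (EuclideanSpace ℝ ι)) :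
    volume U ≤ Metric.ediam U ^ Fintype.card ι := by
  let e := (MeasurableEquiv.toLp 2 (ι → ℝ)).symm
  have he : LipschitzWith 1 e := PiLp.lipschitzWith_ofLp 2 fun _ : ι => ℝ
  calc volume U = volume (e ⁻¹' (e '' U)) := by rw [Set.preimage_image_eq U e.injective]
    _ = volume (e '' U) :=
      (EuclideanSpace.volume_preserving_symm_measurableEquiv_toLp ι).measure_preimage_equiv _
    _ ≤ Metric.ediam (e '' U) ^ Fintype.card ι := Real.volume_pi_le_diam_pow _
    _ ≤ Metric.ediam U ^ Fintype.card ι := by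
      gcongr
      simpa using he.ediam_image_le U

theorem isFrostman_volume (n : ℕ) :
    IsFrostman n (volume : Measure (EuclideanSpace ℝ (Fin n))) :=
  ⟨1, fun U => by simpa using volume_le_ediam_pow U⟩

theorem isClosed_unitCube (n : ℕ) : IsClosed (unitCube n) := by
  simp only [unitCube, Set.ofPred_forall]
  exact isClosed_iInter fun i => isClosed_Icc.preimage (by fun_prop)

theorem volume_unitCube (n : ℕ) : volume (unitCube n) = 1 := by
  have hpre : unitCube n = WithLp.ofLp ⁻¹' Set.Icc 0 1 := Set.ext fun x => forall_and
  rw [hpre, (PiLp.volume_preserving_ofLp (Fin n)).measure_preimage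
    measurableSet_Icc.nullMeasurableSet, Real.volume_Icc_pi]
  simp

theorem dimH_le_natCast {n : ℕ} (A : Set (EuclideanSpace ℝ (Fin n))) : dimH A ≤ n := by
  simpa only [Real.dimH_univ_eq_finrank, finrank_euclideanSpace_fin] using
    dimH_mono (Set.subset_univ A)

end UnitCube

theorem corollary4p3 (n : ℕ) (E : Setoid (EuclideanSpace ℝ (Fin n))) (hE : IsCountableBorel E) :
    (∀ g : ℝ≥0 → ℝ≥0, IsGauge g → LowerOrder g (fun t => t ^ n) →
      ∃ A : Set (EuclideanSpace ℝ (Fin n)), IsClosed A ∧ A ⊆ unitCube n ∧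
        IsSmooth (restrictSetoid E A) ∧ 0 < gaugeMeasure g A) ∧
    ∃ A : Set (EuclideanSpace ℝ (Fin n)), IsClosed A ∧ A ⊆ unitCube n ∧
      IsSmooth (restrictSetoid E A) ∧ dimH A = n := by
  obtain ⟨hgauge, A, hAQ, hA, hsmooth, hdim⟩ := corollary4p3_general hE (isFrostman_volume n)
    (isClosed_unitCube n).measurableSet (by simp [volume_unitCube]) (by simp [volume_unitCube])
  refine ⟨fun g hg hlow => ?_, A, hA.isClosed, hAQ, hsmooth,
    (dimH_le_natCast A).antisymm (mod_cast hdim)⟩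
  obtain ⟨A, hAQ, hA, hsmooth, hpos⟩ := hgauge g hg (by simpa using hlow)
  exact ⟨A, hA.isClosed, hAQ, hsmooth, hpos⟩
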